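/- Let $\Theta$ be a Polish metric space with its Borel $\sigma$-algebra. Call a measure on $\Theta$ locally finite if it is finite on measurable sets of bounded diameter, and let $\mathrm{BM}_+(\Theta)$ be the set of nonnegative bounded measurable functions on $\Theta$ with bounded support. For $c>0$ and locally finite measures $H, M$ on $\Theta$, a locally finite random measure $X$ on $\Theta$ is a noncentral gamma process, $X\sim \mathrm{Nc}\mathcal{G}a\mathrm{P}(H,M,c^{-1})$, if for all $f\in \mathrm{BM}_+(\Theta)$ $$\mathrm{E}\Big(e^{-\int f\,\mathrm{d}X}\Big)=\exp\Big(-\int_\Theta \log(1+c f)\,\mathrm{d}H-\int_\Theta \frac{c f}{1+c f}\,\mathrm{d}M\Big).$$ Let $H$ be a locally finite measure on $\Theta$, let $\beta_t>0$ and $c_t>0$ for $t\ge 2$, and let $(W_t)_{t\ge 1}$ be an M-ARG(1) process, that is, a Markov process of locally finite random measures on $\Theta$, with arbitrary initial value $W_1$, such that for every $t\ge 1$ the conditional law of $W_{t+1}$ given $W_t$ is $\mathrm{Nc}\mathcal{G}a\mathrm{P}(H,\beta_{t+1}W_t,c_{t+1}^{-1})$. Put $\rho_j=\beta_j c_j$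 for $j \ge 2$ and, for $t,h\ge 1$, $$\rho_{t+h|t}=\prod_{j=t+1}^{t+h}\rho_j,\qquad c_{t+h|t}=c_{t+h}+\sum_{j=t+1}^{t+h-1}c_j\prod_{i=j+1}^{t+h}\rho_i .$$ Then for all $t\ge 1$, $h\ge 1$ and every measurable set $A\subset\Theta$, almost surely, $$\mathrm{E}\big(W_{t+h}(A)\mid W_t\big)=c_{t+h|t}\,H(A)+\rho_{t+h|t}\,W_t(A),$$ where both sides take values in $[0,\infty]$ and the conditional expectation is that of a $[0,\infty]$-valued random variable. -/

import Mathlib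

open MeasureTheory ProbabilityTheory
open scoped NNReal ENNReal

noncomputable section

/-- A measure on a metric space is *locally finite* (in the sense of random measure theory) if it
gives finite mass to every measurable set of bounded diameter. -/
def BoundedlyFinite {Θ : Type*} [MetricSpace Θ] [MeasurableSpace Θ] (m : Measure Θ) : Prop :=
  ∀ B : Set Θ, MeasurableSet B → Bornology.IsBounded B → m B < ∞

/-- The class `BM₊(Θ)` of nonnegative, bounded, measurable functions with bounded support. -/
structure IsBMPlus {Θ : Type*} [MetricSpace Θ] [MeasurableSpace Θ] (f : Θ → ℝ) : Prop where
  measurable : Measurable f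
  nonneg : ∀ θ, 0 ≤ f θ
  bounded : ∃ C : ℝ, ∀ θ, f θ ≤ C
  support_bounded : Bornology.IsBounded (Function.support f)

/-- `Q`, a law on the space of measures on `Θ`, is the law of a noncentral gamma process with base
measures `H` and `M` and scale `c` (that is, with rate `c⁻¹`): a locally finite random measure
whose Laplace functional is
`f ↦ exp (- ∫ log (1 + c f) dH - ∫ c f / (1 + c f) dM)` on `BM₊(Θ)`. -/
structure IsNoncentralGammaProcess {Θ : Type*} [MetricSpace Θ] [MeasurableSpace Θ]
    (H M : Measure Θ) (c : ℝ≥0) (Q : Measure (Measure Θ)) : Prop where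
  isProbabilityMeasure : IsProbabilityMeasure Q
  base_finite : BoundedlyFinite H
  noncentral_finite : BoundedlyFinite M
  ae_finite : ∀ᵐ m ∂Q, BoundedlyFinite m
  laplace : ∀ f : Θ → ℝ, IsBMPlus f →
    ∫ m, Real.exp (-∫ θ, f θ ∂m) ∂Q =
      Real.exp (-(∫ θ, Real.log (1 + c * f θ) ∂H) - ∫ θ, c * f θ / (1 + c * f θ) ∂M)

/-- The path `(W₁, …, Wₜ)` of a measure-valued process up to time `t`. -/
def pastPath {Ω Θ : Type*} [MeasurableSpace Θ] (W : ℕ → Ω → Measure Θ) (t : ℕ) (ω : Ω) :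
    Finset.Icc 1 t → Measure Θ :=
  fun s => W s ω

/-- The last value `Wₜ` of a path `(W₁, …, Wₜ)`, for `t ≥ 1`. -/
def lastValue {Θ : Type*} [MeasurableSpace Θ] (t : ℕ) (ht : 1 ≤ t)
    (w : Finset.Icc 1 t → Measure Θ) : Measure Θ :=
  w ⟨t, Finset.mem_Icc.2 ⟨ht, le_rfl⟩⟩

theorem measurable_lastValue {Θ : Type*} [MeasurableSpace Θ] (t : ℕ) (ht : 1 ≤ t) :
    Measurable (lastValue (Θ := Θ) t ht) :=
  measurable_pi_apply _

/-- `(W_t)_{t ≥ 1}` is a measure-valued autoregressive gamma process of order 1 with base measure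
`H` and parameters `(β_t, c_t)_{t ≥ 2}`: a Markov process of locally finite random measures such
that the conditional law of `W_{t+1}` given `W_t` is that of a noncentral gamma process with base
measures `H` and `β_{t+1} W_t` and scale `c_{t+1}`. The initial value `W₁` is an arbitrary
locally finite random measure. The values `W 0`, `β 0`, `β 1`, `c 0`, `c 1` play no role. -/
structure IsMARG {Ω Θ : Type*} [MeasurableSpace Ω] [MetricSpace Θ] [MeasurableSpace Θ]
    (P : Measure Ω) (H : Measure Θ) (β c : ℕ → ℝ≥0) (W : ℕ → Ω → Measure Θ) : Prop where
  base_finite : BoundedlyFinite H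
  beta_pos : ∀ t, 2 ≤ t → 0 < β t
  c_pos : ∀ t, 2 ≤ t → 0 < c t
  measurable : ∀ t, 1 ≤ t → Measurable (W t)
  ae_finite : ∀ t, 1 ≤ t → ∀ᵐ ω ∂P, BoundedlyFinite (W t ω)
  /-- There is a transition kernel `κ` from time `t` to time `t + 1`: the conditional law of
  `W_{t+1}` given the whole past `(W₁, …, Wₜ)` is `κ Wₜ` (so it depends on the past only through
  `Wₜ`), and `κ Wₜ` is almost surely a noncentral gamma law. -/
  transition : ∀ (t : ℕ) (ht : 1 ≤ t), ∃ κ : Kernel (Measure Θ) (Measure Θ), IsMarkovKernel κ ∧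
    HasCondDistrib (W (t + 1)) (pastPath W t)
      (κ.comap (lastValue t ht) (measurable_lastValue t ht)) P ∧
    ∀ᵐ ω ∂P, IsNoncentralGammaProcess H (β (t + 1) • W t ω) (c (t + 1)) (κ (W t ω))

/-- `ρ_j = β_j c_j`. -/
def rho (β c : ℕ → ℝ≥0) (j : ℕ) : ℝ≥0 := β j * c j

/-- `ρ_{t+h|t} = ∏_{j=t+1}^{t+h} ρ_j`. -/
def rhoLag (β c : ℕ → ℝ≥0) (t h : ℕ) : ℝ≥0 := ∏ j ∈ Finset.Icc (t + 1) (t + h), rho β c j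

/-- `c_{t+h|t} = c_{t+h} + ∑_{j=t+1}^{t+h-1} c_j ∏_{i=j+1}^{t+h} ρ_i`, for `h ≥ 1`. -/
def cLag (β c : ℕ → ℝ≥0) (t h : ℕ) : ℝ≥0 :=
  c (t + h) + ∑ j ∈ Finset.Ico (t + 1) (t + h), c j * ∏ i ∈ Finset.Icc (j + 1) (t + h), rho β c i

end

open Filter Topology

/-! A noncentral gamma process has mean measure `c H + c M`: along `s · 1_B` with `B` bounded, both
`log (1 + c s)` and `c s / (1 + c s)` have slope `c` at `s = 0`, and exhaustion by balls removes
boundedness (`IsNoncentralGammaProcess.lintegral_apply`). With `M = β W_t`, one transition therefore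
acts on conditional means as the affine map `x ↦ c H(A) + ρ x`; composing `h` of these gives `cLag`
and `rhoLag`. The tower property is used in integrated form, over events `W t ⁻¹' S`
(`setLIntegral_succ`, `setLIntegral_add`). Everything stays in `[0, ∞]`, so no moment of `W t` has
to be finite. -/

/-- The first moment of a nonnegative variable is the derivative at `0` of its Laplace transform
`s ↦ E (exp (- s X))`, up to sign. -/
theorem lintegral_ofReal_eq_of_tendsto_laplace {α : Type*} [MeasurableSpace α] {Q : Measure α}
    [IsProbabilityMeasure Q] {X : α → ℝ} (hX : Measurable X) (hX0 : ∀ a, 0 ≤ X a) {D : ℝ}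
    (hD : Tendsto (fun n : ℕ => (n + 1 : ℝ) *
      (1 - ∫ a, Real.exp (-((n + 1 : ℝ)⁻¹ * X a)) ∂Q)) atTop (𝓝 D)) :
    ∫⁻ a, ENNReal.ofReal (X a) ∂Q = ENNReal.ofReal D := by
  set F : ℕ → α → ℝ := fun n a => (n + 1 : ℝ) * (1 - Real.exp (-((n + 1 : ℝ)⁻¹ * X a))) with hF
  have hFm : ∀ n, Measurable (F n) := fun n => by fun_prop
  have hexp : ∀ (n : ℕ) a, Real.exp (-((n + 1 : ℝ)⁻¹ * X a)) ≤ 1 := fun n a => by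
    rw [Real.exp_le_one_iff, neg_nonpos]
    exact mul_nonneg (by positivity) (hX0 a)
  have hF0 : ∀ n a, 0 ≤ F n a := fun n a =>
    mul_nonneg (by positivity) (sub_nonneg.2 (hexp n a))
  have hFX : ∀ n a, F n a ≤ X a := fun n a => by
    have h1 := Real.add_one_le_exp (-((n + 1 : ℝ)⁻¹ * X a))
    have hn : (0 : ℝ) < n + 1 := by positivity
    calc F n a ≤ (n + 1 : ℝ) * ((n + 1 : ℝ)⁻¹ * X a) := by
          apply mul_le_mul_of_nonneg_left _ hn.le
          linarith
      _ = X a := mul_inv_cancel_left₀ hn.ne' _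
  have hint : ∀ n : ℕ, Integrable (fun a => Real.exp (-((n + 1 : ℝ)⁻¹ * X a))) Q := fun n =>
    Integrable.of_bound (by fun_prop) 1 (ae_of_all _ fun a => by
      rw [Real.norm_eq_abs, abs_of_pos (Real.exp_pos _)]
      exact hexp n a)
  have hFint : ∀ n, ∫⁻ a, ENNReal.ofReal (F n a) ∂Q = ENNReal.ofReal ((n + 1 : ℝ) *
      (1 - ∫ a, Real.exp (-((n + 1 : ℝ)⁻¹ * X a)) ∂Q)) := fun n => by
    have hi : Integrable (F n) Q := ((integrable_const 1).sub (hint n)).const_mul _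
    rw [← ofReal_integral_eq_lintegral_ofReal hi (ae_of_all _ (hF0 n)), integral_const_mul, integral_sub (integrable_const 1) (hint n)]
    simp
  have hlim : Tendsto (fun n => ∫⁻ a, ENNReal.ofReal (F n a) ∂Q) atTop
      (𝓝 (ENNReal.ofReal D)) := by
    simp_rw [hFint]
    exact ENNReal.tendsto_ofReal hD
  have hpt : ∀ a, Tendsto (fun n => F n a) atTop (𝓝 (X a)) := fun a => by
    have hd : HasDerivAt (fun s : ℝ => -Real.exp (-(s * X a))) (X a) 0 := by
      convert! (((hasDerivAt_id (0 : ℝ)).mul_const (X a)).fun_neg.exp).fun_neg using 1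
      simp
    have hs : Tendsto (fun n : ℕ => (n + 1 : ℝ)⁻¹) atTop (𝓝[≠] 0) := by
      refine tendsto_nhdsWithin_iff.2 ⟨?_, Eventually.of_forall fun n => ?_⟩
      · simpa using tendsto_one_div_add_atTop_nhds_zero_nat (𝕜 := ℝ)
      · exact inv_ne_zero (by positivity)
    refine (hd.tendsto_slope_zero.comp hs).congr fun n => ?_
    simp [hF, sub_eq_neg_add]
    exact Or.inl (by ring)
  -- Since `F n → X` pointwise, Fatou gives `≤`; since `F n ≤ X`, monotonicity gives `≥`.
  -- Integrability of `X` is not needed.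
  refine le_antisymm ?_ ?_
  · calc ∫⁻ a, ENNReal.ofReal (X a) ∂Q
        = ∫⁻ a, liminf (fun n => ENNReal.ofReal (F n a)) atTop ∂Q :=
          lintegral_congr fun a => (ENNReal.tendsto_ofReal (hpt a)).liminf_eq.symm
      _ ≤ liminf (fun n => ∫⁻ a, ENNReal.ofReal (F n a) ∂Q) atTop :=
          lintegral_liminf_le fun n => (hFm n).ennreal_ofReal
      _ = ENNReal.ofReal D := hlim.liminf_eq
  · exact le_of_tendsto' hlim fun n =>
      lintegral_mono fun a => ENNReal.ofReal_le_ofReal (hFX n a)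

/-- Integral of a function of an indicator that vanishes at `0`. -/
theorem integral_comp_indicator_const {Θ : Type*} [MeasurableSpace Θ] (m : Measure Θ) {B : Set Θ}
    (hB : MeasurableSet B) (s : ℝ) (g : ℝ → ℝ) (hg : g 0 = 0) :
    ∫ θ, g (B.indicator (fun _ => s) θ) ∂m = g s * m.real B := by
  have : (fun θ => g (B.indicator (fun _ => s) θ)) = B.indicator fun _ => g s := by
    funext θ
    by_cases h : θ ∈ B <;> simp [h, hg]
  rw [this, integral_indicator_const _ hB, smul_eq_mul, mul_comm]

theorem isBMPlus_indicator_const {Θ : Type*} [MetricSpace Θ] [MeasurableSpace Θ] {B : Set Θ}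
    (hB : MeasurableSet B) (hb : Bornology.IsBounded B) {s : ℝ} (hs : 0 ≤ s) :
    IsBMPlus (B.indicator fun _ => s) where
  measurable := measurable_const.indicator hB
  nonneg := Set.indicator_nonneg fun _ _ => hs
  bounded := ⟨s, fun _ => Set.indicator_le_self' (fun _ _ => hs) _⟩
  support_bounded := hb.subset Set.support_indicator_subset

namespace IsNoncentralGammaProcess

variable {Θ : Type*} [MetricSpace Θ] [MeasurableSpace Θ] {H M : Measure Θ} {c : ℝ≥0}
  {Q : Measure (Measure Θ)}

/-- The mean measure of a noncentral gamma process, on bounded sets. -/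
theorem lintegral_apply_of_isBounded (hQ : IsNoncentralGammaProcess H M c Q) {B : Set Θ}
    (hB : MeasurableSet B) (hb : Bornology.IsBounded B) :
    ∫⁻ m, m B ∂Q = c * H B + c * M B := by
  have := hQ.isProbabilityMeasure
  have hH := (hQ.base_finite B hB hb).ne
  have hM := (hQ.noncentral_finite B hB hb).ne
  have hlap : ∀ s : ℝ, 0 ≤ s → ∫ m, Real.exp (-(s * m.real B)) ∂Q =
      Real.exp (-(Real.log (1 + c * s) * H.real B) - c * s / (1 + c * s) * M.real B) := by
    intro s hs
    have h := hQ.laplace _ (isBMPlus_indicator_const hB hb hs)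
    rw [integral_comp_indicator_const H hB s (fun x => Real.log (1 + c * x)) (by simp),
      integral_comp_indicator_const M hB s (fun x => c * x / (1 + c * x)) (by simp)] at h
    rw [← h]
    exact integral_congr_ae (ae_of_all _ fun m => by
      simp only [integral_comp_indicator_const m hB s (fun x => x) rfl])
  have hd : HasDerivAt (fun s : ℝ => -Real.exp (-(Real.log (1 + c * s) * H.real B) -
      c * s / (1 + c * s) * M.real B)) (c * H.real B + c * M.real B) 0 := by
    have h1 : HasDerivAt (fun s : ℝ => (c : ℝ) * s) c 0 := by
      simpa using (hasDerivAt_id (0 : ℝ)).const_mul (c : ℝ)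
    have h2 : HasDerivAt (fun s : ℝ => 1 + (c : ℝ) * s) c 0 := h1.const_add 1
    have h3 := (h2.log (by simp)).mul_const (H.real B)
    have h4 := (h1.div h2 (by simp)).mul_const (M.real B)
    convert! (h3.neg.sub h4).exp.neg using 1
    simp
    ring
  have hs : Tendsto (fun n : ℕ => (n + 1 : ℝ)⁻¹) atTop (𝓝[≠] 0) := by
    refine tendsto_nhdsWithin_iff.2 ⟨?_, Eventually.of_forall fun n => ?_⟩
    · simpa using tendsto_one_div_add_atTop_nhds_zero_nat (𝕜 := ℝ)
    · exact inv_ne_zero (by positivity)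
  have key := lintegral_ofReal_eq_of_tendsto_laplace (Q := Q) (X := fun m => m.real B)
    (D := c * H.real B + c * M.real B) (Measure.measurable_coe hB).ennreal_toReal
    (fun m => measureReal_nonneg) (by
      refine (hd.tendsto_slope_zero.comp hs).congr fun n => ?_
      rw [hlap _ (by positivity)]
      simp [sub_eq_neg_add]
      exact Or.inl (by ring))
  rw [ENNReal.ofReal_add (by positivity) (by positivity), ENNReal.ofReal_mul (by positivity),
    ENNReal.ofReal_mul (by positivity), ENNReal.ofReal_coe_nnreal, ofReal_measureReal hH,
    ofReal_measureReal hM] at key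
  rw [← key]
  refine lintegral_congr_ae ?_
  -- `m.real B` is `0` when `m B = ∞`; almost sure local finiteness makes this harmless.
  filter_upwards [hQ.ae_finite] with m hm
  exact (ofReal_measureReal (hm B hB hb).ne).symm

/-- The mean measure of a noncentral gamma process is `c H + c M`. -/
theorem lintegral_apply [OpensMeasurableSpace Θ] (hQ : IsNoncentralGammaProcess H M c Q)
    {A : Set Θ} (hA : MeasurableSet A) :
    ∫⁻ m, m A ∂Q = c * H A + c * M A := by
  rcases isEmpty_or_nonempty Θ with hΘ | ⟨⟨x⟩⟩
  · simp [Set.eq_empty_of_isEmpty A]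
  set B : ℕ → Set Θ := fun n => A ∩ Metric.ball x n
  have hBmono : Monotone B := fun i j hij =>
    Set.inter_subset_inter_right _ (Metric.ball_subset_ball (by exact_mod_cast hij))
  have hBU : ⋃ n, B n = A := by
    rw [← Set.inter_iUnion, Metric.iUnion_ball_nat, Set.inter_univ]
  have hBm : ∀ n, MeasurableSet (B n) := fun n => hA.inter measurableSet_ball
  have hBb : ∀ n, Bornology.IsBounded (B n) := fun n =>
    Metric.isBounded_ball.subset Set.inter_subset_right
  -- As `Measure.join Q` is itself a measure, equality on the `B n` passes to `A` by continuity from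
  -- below on both sides.
  have heq : ∀ n, Measure.join Q (B n) = (c • H + c • M) (B n) := fun n => by
    rw [Measure.join_apply (hBm n), hQ.lintegral_apply_of_isBounded (hBm n) (hBb n)]
    simp [Measure.nnreal_smul_coe_apply]
  calc ∫⁻ m, m A ∂Q = Measure.join Q A := (Measure.join_apply hA).symm
    _ = (c • H + c • M) A := by
      rw [← hBU, hBmono.measure_iUnion, hBmono.measure_iUnion]
      simp_rw [heq]
    _ = c * H A + c * M A := by simp [Measure.nnreal_smul_coe_apply]

end IsNoncentralGammaProcess

theorem measurable_pastPath {Ω Θ : Type*} [MeasurableSpace Ω] [MeasurableSpace Θ]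
    {W : ℕ → Ω → Measure Θ} (hW : ∀ t, 1 ≤ t → Measurable (W t)) (t : ℕ) :
    Measurable (pastPath W t) :=
  measurable_pi_lambda _ fun s => hW s (Finset.mem_Icc.1 s.2).1

/-- The new summand `j = t + h` carries the single factor `ρ_{t+h+1}` and is the image of the
leading term `c (t + h)`. The recursion needs `1 ≤ h`: `cLag β c t 0` is `c t`, not the intercept
`0`. -/
theorem cLag_succ (β c : ℕ → ℝ≥0) (t : ℕ) {h : ℕ} (hh : 1 ≤ h) :
    cLag β c t (h + 1) = c (t + h + 1) + rho β c (t + h + 1) * cLag β c t h := by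
  unfold cLag
  rw [← add_assoc t h 1, Finset.sum_Ico_succ_top (by omega), mul_add, Finset.mul_sum,
    add_comm (rho _ _ _ * c (t + h))]
  simp only [Finset.Icc_self, Finset.prod_singleton]
  rw [mul_comm (c (t + h))]
  congr 2
  refine Finset.sum_congr rfl fun j hj => ?_
  rw [Finset.prod_Icc_succ_top (by have := Finset.mem_Ico.1 hj; omega)]
  ring

theorem rhoLag_succ (β c : ℕ → ℝ≥0) (t h : ℕ) :
    rhoLag β c t (h + 1) = rho β c (t + h + 1) * rhoLag β c t h := by
  unfold rhoLag
  rw [← add_assoc t h 1, Finset.prod_Icc_succ_top (by omega), mul_comm]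

namespace IsMARG

variable {Ω Θ : Type*} [MeasurableSpace Ω] [MetricSpace Θ] [MeasurableSpace Θ]
  [OpensMeasurableSpace Θ] {P : Measure Ω} [IsProbabilityMeasure P] {H : Measure Θ}
  {β c : ℕ → ℝ≥0} {W : ℕ → Ω → Measure Θ}

/-- One-step prediction, integrated over an event of the past. -/
theorem setLIntegral_succ (hW : IsMARG P H β c W) {t : ℕ} (ht : 1 ≤ t)
    {S : Set (Finset.Icc 1 t → Measure Θ)} (hS : MeasurableSet S)
    {A : Set Θ} (hA : MeasurableSet A) :
    ∫⁻ ω in pastPath W t ⁻¹' S, W (t + 1) ω A ∂P =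
      c (t + 1) * H A * P (pastPath W t ⁻¹' S) +
        rho β c (t + 1) * ∫⁻ ω in pastPath W t ⁻¹' S, W t ω A ∂P := by
  obtain ⟨κ, hκ, hdist, hgam⟩ := hW.transition t ht
  have hpm := measurable_pastPath hW.measurable t
  have hAm : Measurable fun m : Measure Θ => m A := Measure.measurable_coe hA
  have hWA : Measurable fun ω => W t ω A := hAm.comp (hW.measurable t ht)
  -- A function of the pair (past, next value), so that the joint law disintegrates through `κ`.
  set g : (Finset.Icc 1 t → Measure Θ) × Measure Θ → ℝ≥0∞ :=
    (Prod.fst ⁻¹' S).indicator fun p => p.2 A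
  have hg : Measurable g := (hAm.comp measurable_snd).indicator (measurable_fst hS)
  calc ∫⁻ ω in pastPath W t ⁻¹' S, W (t + 1) ω A ∂P
      = ∫⁻ ω, g (pastPath W t ω, W (t + 1) ω) ∂P := by
        rw [← lintegral_indicator (hpm hS)]
        rfl
    _ = ∫⁻ p, g p ∂(P.map (pastPath W t) ⊗ₘ
          κ.comap (lastValue t ht) (measurable_lastValue t ht)) := by
        rw [← HasLaw.map_eq hdist, lintegral_map hg
          (hpm.prodMk (hW.measurable (t + 1) (by omega)))]
    _ = ∫⁻ ω, ∫⁻ m, g (pastPath W t ω, m) ∂(κ (W t ω)) ∂P := by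
        rw [Measure.lintegral_compProd hg, lintegral_map (hg.lintegral_kernel_prod_right') hpm]
        rfl
    _ = ∫⁻ ω in pastPath W t ⁻¹' S, ∫⁻ m, m A ∂(κ (W t ω)) ∂P := by
        rw [← lintegral_indicator (hpm hS)]
        refine lintegral_congr fun ω => ?_
        by_cases h : pastPath W t ω ∈ S <;> simp [g, Set.indicator, h]
    _ = ∫⁻ ω in pastPath W t ⁻¹' S, (c (t + 1) * H A + rho β c (t + 1) * W t ω A) ∂P := by
        refine lintegral_congr_ae (ae_restrict_of_ae ?_)
        filter_upwards [hgam] with ω hω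
        rw [hω.lintegral_apply hA]
        simp [Measure.nnreal_smul_coe_apply, rho]
        ring
    _ = _ := by
        rw [lintegral_add_left measurable_const, lintegral_const_mul _ hWA]
        simp

/-- `h`-step prediction, integrated over an event of time `t`. -/
theorem setLIntegral_add (hW : IsMARG P H β c W) {t h : ℕ} (ht : 1 ≤ t) (hh : 1 ≤ h)
    {S : Set (Measure Θ)} (hS : MeasurableSet S) {A : Set Θ} (hA : MeasurableSet A) :
    ∫⁻ ω in W t ⁻¹' S, W (t + h) ω A ∂P =
      cLag β c t h * H A * P (W t ⁻¹' S) +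
        rhoLag β c t h * ∫⁻ ω in W t ⁻¹' S, W t ω A ∂P := by
  -- The event on `W t` belongs to the past at every later time `t + k`. Here the Markov property
  -- given the whole past is used.
  have step : ∀ k, ∫⁻ ω in W t ⁻¹' S, W (t + k + 1) ω A ∂P =
      c (t + k + 1) * H A * P (W t ⁻¹' S) +
        rho β c (t + k + 1) * ∫⁻ ω in W t ⁻¹' S, W (t + k) ω A ∂P := fun k => by
    have hev : Measurable fun w : Finset.Icc 1 (t + k) → Measure Θ =>
        w ⟨t, Finset.mem_Icc.2 ⟨ht, by omega⟩⟩ := measurable_pi_apply _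
    exact hW.setLIntegral_succ (t := t + k) (by omega) (hev hS) hA
  induction h, hh using Nat.le_induction with
  | base =>
    have := step 0
    simpa [cLag, rhoLag] using this
  | succ h hh ih =>
    rw [← add_assoc, step h, ih, cLag_succ β c t hh, rhoLag_succ]
    push_cast
    ring

end IsMARG

theorem corollary1 {Ω Θ : Type*} [MeasurableSpace Ω]
    [MetricSpace Θ] [PolishSpace Θ] [MeasurableSpace Θ] [BorelSpace Θ]
    (P : Measure Ω) [IsProbabilityMeasure P]
    (H : Measure Θ) (β c : ℕ → ℝ≥0) (W : ℕ → Ω → Measure Θ)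
    (hW : IsMARG P H β c W)
    (t h : ℕ) (ht : 1 ≤ t) (hh : 1 ≤ h) (A : Set Θ) (hA : MeasurableSet A) :
    condLExp (MeasurableSpace.comap (W t) inferInstance) P (fun ω => W (t + h) ω A)
      =ᵐ[P] fun ω => (cLag β c t h : ℝ≥0∞) * H A + (rhoLag β c t h : ℝ≥0∞) * W t ω A := by
  have hWt := hW.measurable t ht
  have hAm : Measurable fun m : Measure Θ => m A := Measure.measurable_coe hA
  -- It suffices that the right side is `σ(W t)`-measurable and has the correct integral over each
  -- `W t ⁻¹' S`.
  refine (ae_eq_condLExp hWt.comap_le P _ ?_ ?_).symm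
  · exact ((hAm.const_mul _).const_add _).comp (comap_measurable (W t))
  · rintro _ ⟨S, hS, rfl⟩
    have hWA : Measurable fun ω => W t ω A := hAm.comp hWt
    rw [hW.setLIntegral_add ht hh hS hA, lintegral_add_left measurable_const,
      lintegral_const_mul _ hWA]
    simp
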